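/- Let $K$ be a field of characteristic zero and let $q\in K$ be nonzero and not a root of unity. For $m,n\ge 0$ let $\mathcal{O}_q(M(m,n))$ be the $K$-algebra generated by $x_{ij}$ ($1\le i\le m$, $1\le j\le n$) subject to the relations \[ \begin{array}{ll} x_{ij}x_{il}=q\,x_{il}x_{ij} & (j<l),\\ x_{ij}x_{kj}=q\,x_{kj}x_{ij} & (i<k),\\ x_{ij}x_{kl}=x_{kl}x_{ij} & (k<i,\ j<l),\\ x_{ij}x_{kl}-x_{kl}x_{ij}=(q-q^{-1})\,x_{il}x_{kj} & (i<k,\ j<l), \end{array} \] graded with every $x_{ij}$ of degree one. For $t$-element sets $I=\{i_1<\dots<i_t\}\subseteq\{1,\dots,m\}$ and $J=\{j_1<\dots<j_t\}\subseteq\{1,\dots,n\}$, the quantum minor $[I\mid J]$ is $\sum_{\sigma\in S_t}(-q)^{\ell(\sigma)}x_{i_1j_{\sigma(1)}}\cdots x_{i_tj_{\sigma(t)}}$, where $\ell(\sigma)$ is the number of inversions of $\sigma$. For $1\le i\le m$ and $1\le k\le n$ let $D_{i*}$ and $D_{*k}$ be the $K$-linear derivations of $\mathcal{O}_q(M(m,n))$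 with $D_{i*}(x_{rs})=\delta_{ir}x_{rs}$ and $D_{*k}(x_{rs})=\delta_{ks}x_{rs}$. Suppose that $m<n$ and that $D$ is a $K$-linear derivation of $\mathcal{O}_q(M(m,n))$ such that (i) $D$ is homogeneous, that is, $D(x_{ij})$ lies in the degree one part of $\mathcal{O}_q(M(m,n))$ for all $i,j$; (ii) $D([1,\dots,m\mid n+1-m,\dots,n])=0$. Then \[ D=\sum_{i=1}^{m}a_iD_{i*}+\sum_{k=1}^{n}b_kD_{*k} \] for some $a_1,\dots,a_m,b_1,\dots,b_n\in K$. -/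

import Mathlib

noncomputable section

namespace QuantumMatrices

/-- The defining relations of the algebra of `m × n` quantum matrices, as relations between
elements of the free algebra on the letters `(i, j)`. -/
inductive Rel {K : Type*} [Field K] (q : K) (m n : ℕ) :
    FreeAlgebra K (Fin m × Fin n) → FreeAlgebra K (Fin m × Fin n) → Prop
  | row (i : Fin m) (j l : Fin n) (hjl : j < l) :
      Rel q m n (FreeAlgebra.ι K (i, j) * FreeAlgebra.ι K (i, l))
        (q • (FreeAlgebra.ι K (i, l) * FreeAlgebra.ι K (i, j)))
  | col (i k : Fin m) (j : Fin n) (hik : i < k) :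
      Rel q m n (FreeAlgebra.ι K (i, j) * FreeAlgebra.ι K (k, j))
        (q • (FreeAlgebra.ι K (k, j) * FreeAlgebra.ι K (i, j)))
  | anti (i k : Fin m) (j l : Fin n) (hki : k < i) (hjl : j < l) :
      Rel q m n (FreeAlgebra.ι K (i, j) * FreeAlgebra.ι K (k, l))
        (FreeAlgebra.ι K (k, l) * FreeAlgebra.ι K (i, j))
  | diag (i k : Fin m) (j l : Fin n) (hik : i < k) (hjl : j < l) :
      Rel q m n
        (FreeAlgebra.ι K (i, j) * FreeAlgebra.ι K (k, l)
          - FreeAlgebra.ι K (k, l) * FreeAlgebra.ι K (i, j))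
        ((q - q⁻¹) • (FreeAlgebra.ι K (i, l) * FreeAlgebra.ι K (k, j)))

/-- The algebra `O_q(M(m,n))` of `m × n` quantum matrices. -/
abbrev QMat {K : Type*} [Field K] (q : K) (m n : ℕ) : Type _ := RingQuot (Rel q m n)

/-- The canonical generator `x_{ij}` of `O_q(M(m,n))`. -/
def X {K : Type*} [Field K] (q : K) {m n : ℕ} (i : Fin m) (j : Fin n) : QMat q m n :=
  RingQuot.mkAlgHom K (Rel q m n) (FreeAlgebra.ι K (i, j))

theorem X_row {K : Type*} [Field K] (q : K) {m n : ℕ} (i : Fin m) {j l : Fin n} (h : j < l) :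
    X q i j * X q i l = q • (X q i l * X q i j) := by
  simpa [X] using RingQuot.mkAlgHom_rel K (Rel.row (q := q) i j l h)

theorem X_col {K : Type*} [Field K] (q : K) {m n : ℕ} {i k : Fin m} (j : Fin n) (h : i < k) :
    X q i j * X q k j = q • (X q k j * X q i j) := by
  simpa [X] using RingQuot.mkAlgHom_rel K (Rel.col (q := q) i k j h)

theorem X_anti {K : Type*} [Field K] (q : K) {m n : ℕ} {i k : Fin m} {j l : Fin n}
    (hki : k < i) (hjl : j < l) :
    X q i j * X q k l = X q k l * X q i j := by
  simpa [X] using RingQuot.mkAlgHom_rel K (Rel.anti (q := q) i k j l hki hjl)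

theorem X_diag {K : Type*} [Field K] (q : K) {m n : ℕ} {i k : Fin m} {j l : Fin n}
    (hik : i < k) (hjl : j < l) :
    X q i j * X q k l - X q k l * X q i j = (q - q⁻¹) • (X q i l * X q k j) := by
  simpa only [X, map_sub, map_mul, map_smul] using
    RingQuot.mkAlgHom_rel K (Rel.diag (q := q) i k j l hik hjl)

/-- The degree `d` part of `O_q(M(m,n))`: the span of the products of `d` generators. -/
def degreePart {K : Type*} [Field K] (q : K) (m n d : ℕ) : Submodule K (QMat q m n) :=
  Submodule.span K (Set.range fun p : Fin m × Fin n => X q p.1 p.2) ^ d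

/-- The length of a permutation: its number of inversions. -/
def permLength {t : ℕ} (σ : Equiv.Perm (Fin t)) : ℕ :=
  (Finset.univ.filter fun p : Fin t × Fin t => p.1 < p.2 ∧ σ p.2 < σ p.1).card

/-- The quantum minor `[I ∣ J]`, for `t`-element index sets `I` and `J`, which are given by
their increasing enumerations. -/
def quantumMinor {K : Type*} [Field K] (q : K) {m n t : ℕ}
    (I : Fin t ↪o Fin m) (J : Fin t ↪o Fin n) : QMat q m n :=
  ∑ σ : Equiv.Perm (Fin t),
    (-q) ^ permLength σ • (List.ofFn fun k : Fin t => X q (I k) (J (σ k))).prod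

/-- The increasing enumeration of the last `m` of the indices `0, …, n - 1`. -/
def lastCols {m n : ℕ} (h : m ≤ n) : Fin m ↪o Fin n :=
  OrderEmbedding.ofStrictMono (fun k => ⟨n - m + k.1, by have := k.2; omega⟩) fun a b hab => by
    have h' : a.1 < b.1 := hab
    exact Fin.mk_lt_mk.2 (by omega)

/-- The rightmost `m × m` quantum minor `[1, …, m ∣ n + 1 - m, …, n]`. -/
def rightmostMinor {K : Type*} [Field K] (q : K) {m n : ℕ} (h : m ≤ n) : QMat q m n :=
  quantumMinor q (RelEmbedding.refl (· ≤ ·)) (lastCols h)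

/-- A `K`-linear derivation of a (not necessarily commutative) `K`-algebra into itself. -/
def IsDerivation {K A : Type*} [CommRing K] [Ring A] [Algebra K A] (D : A →ₗ[K] A) : Prop :=
  ∀ a b : A, D (a * b) = D a * b + a * D b

/-- A linear endomorphism of `O_q(M(m,n))` is homogeneous if it sends every generator into the
degree one part. -/
def IsHomogeneous {K : Type*} [Field K] {q : K} {m n : ℕ}
    (D : QMat q m n →ₗ[K] QMat q m n) : Prop :=
  ∀ (i : Fin m) (j : Fin n), D (X q i j) ∈ degreePart q m n 1

/-- For scalars `a_r`, `b_s`, the algebra map `x_{rs} ↦ x_{rs} + (a_r + b_s) x_{rs} ε` into the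
dual numbers over `O_q(M(m,n))`. -/
def toDual {K : Type*} [Field K] (q : K) {m n : ℕ} (a : Fin m → K) (b : Fin n → K) :
    QMat q m n →ₐ[K] TrivSqZeroExt (QMat q m n) (QMat q m n) :=
  RingQuot.liftAlgHom K ⟨FreeAlgebra.lift K fun p =>
    TrivSqZeroExt.inl (X q p.1 p.2) + TrivSqZeroExt.inr ((a p.1 + b p.2) • X q p.1 p.2), by
      intro x y h
      induction h with
      | row i j l h =>
        ext
        · simpa using X_row q i h
        · simp [X_row q i h, ← add_smul, smul_smul]
          congr 1; ring
      | col i k j h =>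
        ext
        · simpa using X_col q j h
        · simp [X_col q j h, ← add_smul, smul_smul]
          congr 1; ring
      | anti i k j l hki hjl =>
        ext
        · simpa using X_anti q hki hjl
        · simp [X_anti q hki hjl, ← add_smul]
          congr 1; ring
      | diag i k j l hik hjl =>
        ext
        · simpa using X_diag q hik hjl
        · have h := X_diag q hik hjl
          simp only [map_sub, map_mul, map_smul, FreeAlgebra.lift_ι_apply,
            TrivSqZeroExt.snd_sub, TrivSqZeroExt.snd_mul, TrivSqZeroExt.snd_smul,
            TrivSqZeroExt.fst_add, TrivSqZeroExt.snd_add, TrivSqZeroExt.fst_inl,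
            TrivSqZeroExt.fst_inr, TrivSqZeroExt.snd_inl, TrivSqZeroExt.snd_inr,
            add_zero, zero_add, smul_eq_mul, MulOpposite.smul_eq_mul_unop,
            MulOpposite.unop_op, mul_smul_comm, smul_mul_assoc, ← add_smul]
          rw [eq_add_of_sub_eq h]
          module⟩

theorem toDual_X {K : Type*} [Field K] (q : K) {m n : ℕ} (a : Fin m → K) (b : Fin n → K)
    (i : Fin m) (j : Fin n) :
    toDual q a b (X q i j) =
      TrivSqZeroExt.inl (X q i j) + TrivSqZeroExt.inr ((a i + b j) • X q i j) := by
  simp [toDual, X, RingQuot.liftAlgHom_mkAlgHom_apply]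

theorem fst_toDual {K : Type*} [Field K] (q : K) {m n : ℕ} (a : Fin m → K) (b : Fin n → K)
    (x : QMat q m n) : (toDual q a b x).fst = x := by
  have h : (TrivSqZeroExt.fstHom K (QMat q m n) (QMat q m n)).comp (toDual q a b)
      = AlgHom.id K (QMat q m n) := by
    refine RingQuot.ringQuot_ext' K _ _ (FreeAlgebra.hom_ext (funext fun p => ?_))
    have := toDual_X q a b p.1 p.2
    simp only [X] at this
    simp [this]
  exact DFunLike.congr_fun h x

/-- The derivation of `O_q(M(m,n))` with `x_{rs} ↦ (a_r + b_s) x_{rs}`. -/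
def weightDerivation {K : Type*} [Field K] (q : K) {m n : ℕ} (a : Fin m → K) (b : Fin n → K) :
    QMat q m n →ₗ[K] QMat q m n :=
  ((TrivSqZeroExt.sndHom (QMat q m n) (QMat q m n)).restrictScalars K).comp
    (toDual q a b).toLinearMap

theorem weightDerivation_X {K : Type*} [Field K] (q : K) {m n : ℕ} (a : Fin m → K)
    (b : Fin n → K) (i : Fin m) (j : Fin n) :
    weightDerivation q a b (X q i j) = (a i + b j) • X q i j := by
  simp [weightDerivation, toDual_X]

theorem isDerivation_weightDerivation {K : Type*} [Field K] (q : K) {m n : ℕ} (a : Fin m → K)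
    (b : Fin n → K) : IsDerivation (weightDerivation q a b) := by
  intro x y
  simp [weightDerivation, fst_toDual, add_comm]

/-- The row derivation `D_{i*}`: the derivation with `x_{rs} ↦ δ_{ir} x_{rs}`. -/
def rowDerivation {K : Type*} [Field K] (q : K) {m n : ℕ} (i : Fin m) :
    QMat q m n →ₗ[K] QMat q m n :=
  weightDerivation q (Pi.single i 1) 0

/-- The column derivation `D_{*j}`: the derivation with `x_{rs} ↦ δ_{js} x_{rs}`. -/
def colDerivation {K : Type*} [Field K] (q : K) {m n : ℕ} (j : Fin n) :
    QMat q m n →ₗ[K] QMat q m n :=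
  weightDerivation q 0 (Pi.single j 1)

theorem isDerivation_rowDerivation {K : Type*} [Field K] (q : K) {m n : ℕ} (i : Fin m) :
    IsDerivation (rowDerivation q i : QMat q m n →ₗ[K] QMat q m n) :=
  isDerivation_weightDerivation q _ _

theorem isDerivation_colDerivation {K : Type*} [Field K] (q : K) {m n : ℕ} (j : Fin n) :
    IsDerivation (colDerivation q j : QMat q m n →ₗ[K] QMat q m n) :=
  isDerivation_weightDerivation q _ _

theorem rowDerivation_X {K : Type*} [Field K] (q : K) {m n : ℕ} (i r : Fin m) (s : Fin n) :
    rowDerivation q i (X q r s) = if i = r then X q r s else 0 := by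
  by_cases h : i = r
  · subst h; simp [rowDerivation, weightDerivation_X]
  · simp [rowDerivation, weightDerivation_X, h, Ne.symm h]

theorem colDerivation_X {K : Type*} [Field K] (q : K) {m n : ℕ} (j s : Fin n) (r : Fin m) :
    colDerivation q j (X q r s) = if j = s then X q r s else 0 := by
  by_cases h : j = s
  · subst h; simp [colDerivation, weightDerivation_X]
  · simp [colDerivation, weightDerivation_X, h, Ne.symm h]

end QuantumMatrices

end

namespace QuantumMatrices

section

variable {K : Type*} [Field K] {q : K} {m n : ℕ}

/-! Write `D x_ij = ∑ c_ij(k,l) x_kl`. Applying `D` to a defining relation and then a representation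
that kills most generators leaves an equation in a few coefficients. One-dimensional representations
remove `c_ij(k,l)` unless `(k,l)` is `(i,j)` or lies strictly on its diagonal side (both indices
larger or both smaller); a 2 × 2 representation removes the latter (`exists_eigenvalue`). So `D`
scales each generator. The diagonal relation, together with `x_il x_kj ≠ 0`, forces the scalars to
satisfy the rectangle rule, so they split as `a_i + b_j`. No basis of the algebra is needed. -/

theorem exists_algHom {A : Type*} [Ring A] [Algebra K A] (F : Fin m → Fin n → A)
    (row : ∀ i j l, j < l → F i j * F i l = q • (F i l * F i j))
    (col : ∀ i k j, i < k → F i j * F k j = q • (F k j * F i j))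
    (anti : ∀ i k j l, k < i → j < l → F i j * F k l = F k l * F i j)
    (diag : ∀ i k j l, i < k → j < l →
      F i j * F k l - F k l * F i j = (q - q⁻¹) • (F i l * F k j)) :
    ∃ φ : QMat q m n →ₐ[K] A, ∀ i j, φ (X q i j) = F i j := by
  refine ⟨RingQuot.liftAlgHom K ⟨FreeAlgebra.lift K fun p => F p.1 p.2, ?_⟩, fun i j => ?_⟩
  · intro x y h
    induction h with
    | row i j l h => simpa using row i j l h
    | col i k j h => simpa using col i k j h
    | anti i k j l hki hjl => simpa using anti i k j l hki hjl
    | diag i k j l hik hjl => simpa using diag i k j l hik hjl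
  · simp [X, RingQuot.liftAlgHom_mkAlgHom_apply]

/-! ### Representations that detect coefficients -/

/-- The character of `O_q(M(m,n))` that is `1` on one generator and `0` on all the others. -/
theorem exists_character (k : Fin m) (l : Fin n) :
    ∃ φ : QMat q m n →ₐ[K] K,
      ∀ i j, φ (X q i j) = if i = k ∧ j = l then 1 else 0 := by
  -- Every monomial in the relations involves two distinct generators, so both sides vanish.
  apply exists_algHom <;> intros <;> split_ifs <;> first | (exfalso; omega) | simp

/-- The representation in which two generators of one column act as a quantum plane and
all the other generators act as zero. -/
theorem exists_columnRep {i k : Fin m} (hik : i < k) (l : Fin n) :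
    ∃ φ : QMat q m n →ₐ[K] Matrix (Fin 2) (Fin 2) K,
      ∀ r s, φ (X q r s) =
        if r = i ∧ s = l then !![q, 0; 0, 1] else if r = k ∧ s = l then !![0, 1; 0, 0] else 0 := by
  -- Only the column relation for rows `i`, `k` is nontrivial: with `A = diag(q, 1)` and `E` the
  -- other matrix, `AE = qE` and `EA = E`.
  apply exists_algHom <;> intros <;> split_ifs <;> first | (exfalso; omega) | simp

set_option maxHeartbeats 400000 in
/-- A `2 × 2` block of generators with equal antidiagonal entries can be represented with all the
other generators acting as zero. -/
theorem exists_blockHom {A : Type*} [Ring A] [Algebra K A] {i k : Fin m} {j l : Fin n}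
    (hik : i < k) (hjl : j < l) {a b d : A} (hab : a * b = q • (b * a))
    (hbd : b * d = q • (d * b)) (had : a * d - d * a = (q - q⁻¹) • (b * b)) :
    ∃ φ : QMat q m n →ₐ[K] A, ∀ r s, φ (X q r s) =
      if r = i then (if s = j then a else if s = l then b else 0)
      else if r = k then (if s = j then b else if s = l then d else 0) else 0 := by
  apply exists_algHom <;> intros <;> split_ifs <;>
    first | (exfalso; omega) | assumption | simp

/-- The representation on functions on `ℤ` in which a `2 × 2` block of generators acts by weighted
shifts and all the other generators act as zero. -/
theorem exists_blockRep (hq0 : q ≠ 0) {i k : Fin m} {j l : Fin n} (hik : i < k) (hjl : j < l) :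
    ∃ φ : QMat q m n →ₐ[K] Module.End K (ℤ → K), φ (X q i l * X q k j) ≠ 0 := by
  let a : Module.End K (ℤ → K) :=
    -- The weight `q ^ (2z+1)` makes `ad - da` multiplication by `q ^ (2z+1) - q ^ (2z-1) = (q -
    -- q⁻¹) q ^ (2z)`, which is `(q - q⁻¹) b²`.
    { toFun := fun f z => q ^ (2 * z + 1) * f (z + 1)
      map_add' := fun f g => by ext z; simp [mul_add]
      map_smul' := fun c f => by ext z; simp [mul_left_comm] }
  let b : Module.End K (ℤ → K) :=
    { toFun := fun f z => q ^ z * f z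
      map_add' := fun f g => by ext z; simp [mul_add]
      map_smul' := fun c f => by ext z; simp [mul_left_comm] }
  let d : Module.End K (ℤ → K) :=
    { toFun := fun f z => f (z - 1)
      map_add' := fun f g => rfl
      map_smul' := fun c f => rfl }
  have hab : a * b = q • (b * a) := by
    ext f z
    simp only [a, b, Module.End.mul_apply, LinearMap.coe_mk, AddHom.coe_mk, LinearMap.smul_apply,
      Pi.smul_apply, smul_eq_mul, zpow_add₀ hq0, zpow_one]
    ring
  have hbd : b * d = q • (d * b) := by
    ext f z
    simp only [b, d, Module.End.mul_apply, LinearMap.coe_mk, AddHom.coe_mk, LinearMap.smul_apply,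
      Pi.smul_apply, smul_eq_mul, zpow_sub₀ hq0, zpow_one]
    field_simp
  have had : a * d - d * a = (q - q⁻¹) • (b * b) := by
    ext f z
    have h : q ^ (2 * z) = q ^ z * q ^ z := by rw [two_mul, zpow_add₀ hq0]
    simp only [a, b, d, Module.End.mul_apply, LinearMap.coe_mk, AddHom.coe_mk,
      LinearMap.smul_apply, LinearMap.sub_apply, Pi.sub_apply,
      Pi.smul_apply, smul_eq_mul, add_sub_cancel_right, sub_add_cancel, mul_sub, mul_one,
      zpow_add₀ hq0, zpow_sub₀ hq0, h, zpow_ofNat]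
    field_simp
  obtain ⟨φ, hφ⟩ := exists_blockHom hik hjl hab hbd had
  refine ⟨φ, fun h => ?_⟩
  rw [map_mul, hφ, hφ, if_pos rfl, if_neg hjl.ne', if_pos rfl, if_neg hik.ne', if_pos rfl,
    if_pos rfl] at h
  have h1 := congrFun (LinearMap.congr_fun h (fun _ => 1)) 0
  simp [b] at h1

/-! ### Homogeneous derivations are diagonal -/

theorem IsDerivation.map_one {A : Type*} [Ring A] [Algebra K A] {D : A →ₗ[K] A}
    (hD : IsDerivation D) : D 1 = 0 := by
  simpa using hD 1 1

/-- Derivations of `O_q(M(m,n))` that agree on the generators are equal. -/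
theorem IsDerivation.ext_X {D E : QMat q m n →ₗ[K] QMat q m n}
    (hD : IsDerivation D) (hE : IsDerivation E) (h : ∀ i j, D (X q i j) = E (X q i j)) :
    D = E := by
  ext x
  obtain ⟨y, rfl⟩ := RingQuot.mkAlgHom_surjective K (Rel q m n) x
  induction y using FreeAlgebra.induction with
  | grade0 r =>
    rw [AlgHom.commutes, Algebra.algebraMap_eq_smul_one, map_smul, map_smul, hD.map_one,
      hE.map_one]
  | grade1 p => exact h p.1 p.2
  | mul a b ha hb => rw [map_mul, hD, hE, ha, hb]
  | add a b ha hb => rw [map_add, map_add, map_add, ha, hb]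

/-- A homogeneous derivation acts on every generator by a scalar. -/
theorem IsDerivation.exists_eigenvalue (hq : q ≠ 1) (hq2 : q ^ 2 ≠ 1) (hq0 : q ≠ 0)
    {D : QMat q m n →ₗ[K] QMat q m n} (hD : IsDerivation D) (hhom : IsHomogeneous D) :
    ∃ c : Fin m → Fin n → K, ∀ i j, D (X q i j) = c i j • X q i j := by
  have hex : ∀ i j, ∃ c : Fin m × Fin n → K, ∑ p, c p • X q p.1 p.2 = D (X q i j) := by
    intro i j
    have := hhom i j
    rwa [degreePart, pow_one, Submodule.mem_span_range_iff_exists_fun] at this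
  choose c hc using hex
  have hqq : q - q⁻¹ ≠ 0 := by
    rw [sub_ne_zero]
    intro h
    exact hq2 (by rw [sq]; nth_rw 2 [h]; exact mul_inv_cancel₀ hq0)
  have hchar : ∀ {k l} {φ : QMat q m n →ₐ[K] K},
      (∀ i j, φ (X q i j) = if i = k ∧ j = l then 1 else 0) →
      ∀ i j, φ (D (X q i j)) = c i j (k, l) := by
    intro k l φ hφ i j
    rw [← hc, map_sum, Finset.sum_eq_single (k, l)]
    · simp [hφ]
    · rintro ⟨r, s⟩ - hne
      simp only [ne_eq, Prod.mk.injEq] at hne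
      simp [hφ, hne]
    · simp
  -- With `x_il ↦ 1` and all else `0`, the row relation becomes `c = q c`, up to the order of the
  -- two columns.
  have hrow : ∀ i j l, j ≠ l → c i j (i, l) = 0 := by
    intro i j l hjl
    obtain ⟨φ, hφ⟩ := exists_character (q := q) i l
    have h := hchar hφ
    rcases hjl.lt_or_gt with hlt | hlt
    · have e := congrArg (fun x => φ (D x)) (X_row q i hlt)
      simp [hD (X q _ _), hφ, h, hjl] at e
      grind
    · have e := congrArg (fun x => φ (D x)) (X_row q i hlt)
      simp [hD (X q _ _), hφ, h, hjl] at e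
      grind
  have hcol : ∀ i k j, i ≠ k → c i j (k, j) = 0 := by
    intro i k j hik
    obtain ⟨φ, hφ⟩ := exists_character (q := q) k j
    have h := hchar hφ
    rcases hik.lt_or_gt with hlt | hlt
    · have e := congrArg (fun x => φ (D x)) (X_col q j hlt)
      simp [hD (X q _ _), hφ, h, hik] at e
      grind
    · have e := congrArg (fun x => φ (D x)) (X_col q j hlt)
      simp [hD (X q _ _), hφ, h, hik] at e
      grind
  -- A character supported at an antidiagonal corner kills the left side of the diagonal relation,
  -- leaving `(q - q⁻¹) c = 0`.
  have hanti : ∀ i k j l, i < k → j < l → c i l (k, j) = 0 ∧ c k j (i, l) = 0 := by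
    intro i k j l hik hjl
    constructor
    · obtain ⟨φ, hφ⟩ := exists_character (q := q) k j
      have e := congrArg (fun x => φ (D x)) (X_diag q hik hjl)
      simpa [hD (X q _ _), hφ, hchar hφ, hik.ne, hik.ne', hjl.ne, hjl.ne', hqq] using e
    · obtain ⟨φ, hφ⟩ := exists_character (q := q) i l
      have e := congrArg (fun x => φ (D x)) (X_diag q hik hjl)
      simpa [hD (X q _ _), hφ, hchar hφ, hik.ne, hik.ne', hjl.ne, hjl.ne', hqq] using e
  have hcolRep : ∀ {i k : Fin m} {l : Fin n} {φ : QMat q m n →ₐ[K] Matrix (Fin 2) (Fin 2) K},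
      i < k → (∀ r s, φ (X q r s) =
        if r = i ∧ s = l then !![q, 0; 0, 1]
          else if r = k ∧ s = l then !![0, 1; 0, 0] else 0) →
      ∀ r s, φ (D (X q r s)) =
        c r s (i, l) • !![q, 0; 0, 1] + c r s (k, l) • !![0, 1; 0, 0] := by
    intro i k l φ hik hφ r s
    have hne : (i, l) ≠ (k, l) := by simp [hik.ne]
    rw [← hc, map_sum, Fintype.sum_eq_add (i, l) (k, l) hne]
    · simp [hφ, hik.ne']
    · rintro ⟨r', s'⟩ ⟨h1, h2⟩
      simp only [ne_eq, Prod.mk.injEq] at h1 h2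
      simp [hφ, h1, h2]
  -- Characters give only `c - c = 0` here. In the column representation the row relation reads `c
  -- EA = q c AE` (respectively `c EA = q c AE` with the roles of the columns exchanged), once
  -- `hrow` removes the other coefficient; hence `(1 - q²) c = 0`.
  have hdiag : ∀ i k j l, i < k → j < l → c i j (k, l) = 0 ∧ c k l (i, j) = 0 := by
    intro i k j l hik hjl
    constructor
    · obtain ⟨φ, hφ⟩ := exists_columnRep (q := q) hik l
      have e := congrArg (fun x => φ (D x) 0 1) (X_row q i hjl)
      simp [hD (X q _ _), hφ, hcolRep hik hφ, hik.ne, hjl.ne, hrow i j l hjl.ne] at e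
      grind
    · obtain ⟨φ, hφ⟩ := exists_columnRep (q := q) hik j
      have e := congrArg (fun x => φ (D x) 0 1) (X_row q k hjl)
      simp [hD (X q _ _), hφ, hcolRep hik hφ, hik.ne', hjl.ne', hrow k l j hjl.ne'] at e
      grind
  refine ⟨fun i j => c i j (i, j), fun i j => ?_⟩
  rw [← hc, Finset.sum_eq_single (i, j)]
  · rintro ⟨k, l⟩ - hne
    have : c i j (k, l) = 0 := by
      rcases lt_trichotomy i k with hik | rfl | hik <;>
        rcases lt_trichotomy j l with hjl | rfl | hjl
      · exact (hdiag i k j l hik hjl).1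
      · exact hcol i k j hik.ne
      · exact (hanti i k l j hik hjl).1
      · exact hrow i j l hjl.ne
      · exact absurd rfl hne
      · exact hrow i j l hjl.ne'
      · exact (hanti k i j l hik hjl).2
      · exact hcol i k j hik.ne'
      · exact (hdiag k i l j hik hjl).2
    rw [this, zero_smul]
  · simp

/-! ### The rectangle rule -/

/-- The eigenvalues of a diagonal derivation satisfy the rectangle rule. -/
theorem IsDerivation.eigenvalue_add_eigenvalue (hq2 : q ^ 2 ≠ 1) (hq0 : q ≠ 0)
    {D : QMat q m n →ₗ[K] QMat q m n} (hD : IsDerivation D) {c : Fin m → Fin n → K}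
    (hc : ∀ i j, D (X q i j) = c i j • X q i j) {i k : Fin m} {j l : Fin n}
    (hik : i < k) (hjl : j < l) : c i j + c k l = c i l + c k j := by
  obtain ⟨φ, hφ⟩ := exists_blockRep (q := q) hq0 hik hjl
  have hne : X q i l * X q k j ≠ 0 := fun h => hφ (by rw [h, map_zero])
  have hqq : q - q⁻¹ ≠ 0 := by
    rw [sub_ne_zero]
    intro h
    exact hq2 (by rw [sq]; nth_rw 2 [h]; exact mul_inv_cancel₀ hq0)
  have e := congrArg D (X_diag q hik hjl)
  simp only [map_sub, map_smul, hD (X q _ _), hc, smul_mul_assoc, mul_smul_comm] at e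
  -- `D` multiplies the commutator by `c i j + c k l` and the right side of the relation by `c i l +
  -- c k j`.
  have e' : ((c i j + c k l - (c i l + c k j)) * (q - q⁻¹)) • (X q i l * X q k j) = 0 := by
    have h := X_diag q hik hjl
    rw [sub_eq_iff_eq_add] at h
    rw [h] at e
    rw [← sub_eq_zero] at e
    rw [← e]
    module
  rcases smul_eq_zero.1 e' with h | h
  · exact sub_eq_zero.1 ((mul_eq_zero.1 h).resolve_right hqq)
  · exact absurd h hne

theorem IsDerivation.sum_smul {A ι : Type*} [Ring A] [Algebra K A] (s : Finset ι)
    (a : ι → K) {D : ι → A →ₗ[K] A} (hD : ∀ i, IsDerivation (D i)) :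
    IsDerivation (∑ i ∈ s, a i • D i) := by
  intro x y
  simp only [LinearMap.sum_apply, LinearMap.smul_apply, (hD _) x y, smul_add,
    Finset.sum_add_distrib, Finset.sum_mul, Finset.mul_sum, smul_mul_assoc, mul_smul_comm]

theorem IsDerivation.add {A : Type*} [Ring A] [Algebra K A] {D E : A →ₗ[K] A}
    (hD : IsDerivation D) (hE : IsDerivation E) : IsDerivation (D + E) := by
  intro x y
  simp only [LinearMap.add_apply, hD x y, hE x y, add_mul, mul_add]
  abel

/-- A function on a rectangle that satisfies the rectangle rule is a sum of a function of the
row and a function of the column. -/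
theorem exists_eq_add_of_rectangle {c : Fin m → Fin n → K}
    (h : ∀ i k j l, i < k → j < l → c i j + c k l = c i l + c k j) :
    ∃ (a : Fin m → K) (b : Fin n → K), ∀ i j, c i j = a i + b j := by
  rcases m with _ | m
  · exact ⟨0, 0, fun i => i.elim0⟩
  rcases n with _ | n
  · exact ⟨0, 0, fun _ j => j.elim0⟩
  -- Row and column `0` determine `c`; subtracting `c 0 0` corrects for the corner being counted
  -- twice.
  refine ⟨fun i => c i 0, fun j => c 0 j - c 0 0, fun i j => ?_⟩
  rcases eq_or_ne i 0 with rfl | hi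
  · ring
  rcases eq_or_ne j 0 with rfl | hj
  · ring
  linear_combination h 0 i 0 j (Fin.pos_iff_ne_zero.2 hi) (Fin.pos_iff_ne_zero.2 hj)

end

end QuantumMatrices

theorem mainTheorem5 {K : Type*} [Field K] [CharZero K] (q : K) (hq0 : q ≠ 0)
    (hq : ∀ k : ℕ, 0 < k → q ^ k ≠ 1) (m n : ℕ) (hmn : m < n)
    (D : QuantumMatrices.QMat q m n →ₗ[K] QuantumMatrices.QMat q m n)
    (hD : QuantumMatrices.IsDerivation D)
    (hhom : QuantumMatrices.IsHomogeneous D)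
    (hminor : D (QuantumMatrices.rightmostMinor q hmn.le) = 0) :
    ∃ (a : Fin m → K) (b : Fin n → K),
      D = ∑ i, a i • QuantumMatrices.rowDerivation q i
        + ∑ k, b k • QuantumMatrices.colDerivation q k := by
  have hq1 : q ≠ 1 := by simpa using hq 1 one_pos
  have hq2 : q ^ 2 ≠ 1 := hq 2 two_pos
  obtain ⟨c, hc⟩ := hD.exists_eigenvalue hq1 hq2 hq0 hhom
  obtain ⟨a, b, hab⟩ := QuantumMatrices.exists_eq_add_of_rectangle fun i k j l hik hjl =>
    hD.eigenvalue_add_eigenvalue hq2 hq0 hc (i := i) (k := k) (j := j) (l := l) hik hjl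
  refine ⟨a, b, hD.ext_X ?_ fun i j => ?_⟩
  · exact (QuantumMatrices.IsDerivation.sum_smul _ _
      (QuantumMatrices.isDerivation_rowDerivation q)).add
      (QuantumMatrices.IsDerivation.sum_smul _ _ (QuantumMatrices.isDerivation_colDerivation q))
  · simp [hc, hab, QuantumMatrices.rowDerivation_X, QuantumMatrices.colDerivation_X, add_smul]
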